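/- Consider a distributed storage system with $n$ nodes, in which each node stores $\alpha$ fragments over a finite field $\mathbb F_q$ of a source file $s\in\mathbb F_q^M$, where $M=k\alpha$ and $k\ge 1$. A code assigns to each node $i$ a matrix $Q_i\in\mathbb F_q^{M\times\alpha}$, so that node $i$ stores $Q_i^{T}s$. The code has the regenerating code property (RCP) if the contents of any $k$ of the $n$ nodes determine $s$. A repair stage is given by a failed node $f$, a set of at least $k$ surviving helper nodes, an acyclic directed network of links from helpers to helpers or to the new node (which replaces $f$), and a cost $c_{(ij)}\ge 0$ of sending one fragment over the link $(i,j)$. A subgraph is a vector $z=(z_{(ij)})$ of non-negative real numbers, indexed by the links. It is feasible if, in the information flow graph of this stage, all cuts between the source and a data collector have value at least $M$, whenever the collector is connected to the new node and to any $k-1$ surviving nodes. (In that graph the source is joined by infinite-capacity edges to the input vertex of every surviving node; every storage node, including the new one, has an edge of capacity $\alpha$ from its input to its output vertex; a link $(i,j)$ has capacity $z_{(ij)}$ and leads from the output vertex of $i$ to the output vertex of $j$, or to the input vertex of the new node if $j$ is the new node; infinite-capacity edges lead from the output vertices of the nodes to which the collector is connected to the collector.) The linear program minimizes $\sigma_c(z)=\sum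 c_{(ij)}z_{(ij)}$ over the feasible subgraphs. A repair follows an integral subgraph $z$ if exactly $z_{(ij)}$ fragments are sent over each link $(i,j)$, each of them an $\mathbb F_q$-linear combination of fragments stored at $i$ and fragments received by $i$ (surviving node cooperation), the new node stores $\alpha$ linear combinations of the fragments it receives, and all other nodes keep their contents. Theorem. Let a non-empty family of possible repair stages be given, each with an integral feasible subgraph (for instance an integral minimum-cost solution of its linear program). Let $n_{nc}$ be the maximum number of nodes, the new node included, on a directed path of links that ends at the new node, over all stages of the family; this is the maximum number of coding operations that one fragment undergoes in one repair stage. If $$q> d_0=\binom nk M\,n_{nc},$$ then there is a linear network code, that is, an assignment of a code to every finite history of repair stages from the family (the initial code is the one assigned to the empty history), such that 1. the RCP holds after every history, regardless of how many failures and repairs happened and in which order; 2. after every history and for every stage of the family, the next code arises from the current one by a linear repair that follows the given subgraph of this stage. Consequently, whenever the given subgraph of a stage is a minimum-cost solution of its linear program, the cost of that repair equals the minimum of the linear program, so the lower bound given by the linear program is achieved for $\alpha=M/k$. -/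

import Mathlib

open scoped NNReal ENNReal

/-- The network of one repair stage in a system of `n` storage nodes (indexed by `Fin n`) with
reconstruction parameter `k`. The node `failed` has been lost; the index `failed` also stands for
the new node that replaces it. At least `k` surviving nodes (`helpers`) take part. `link a b` says
that there is a direct link from `a` to `b`; links lead from helpers to helpers or to the new node
and form an acyclic network. `cost a b` is the cost of sending one fragment over the link. -/
structure RepairNetwork (n k : ℕ) where
  failed : Fin n
  helpers : Finset (Fin n)
  failed_notMem : failed ∉ helpers
  le_card_helpers : k ≤ helpers.card
  link : Fin n → Fin n → Prop
  tail_mem : ∀ a b, link a b → a ∈ helpers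
  head_mem : ∀ a b, link a b → b ∈ helpers ∨ b = failed
  acyclic : ∀ a, ¬ Relation.TransGen link a a
  cost : Fin n → Fin n → ℝ≥0

/-- Vertices of the modified information flow graph: the source, an input and an output vertex for
each storage node (for the index of the failed node: those of the new node), and one data
collector. -/
inductive FlowVertex (n : ℕ) where
  | source : FlowVertex n
  | input (i : Fin n) : FlowVertex n
  | output (i : Fin n) : FlowVertex n
  | collector : FlowVertex n
  deriving DecidableEq, Fintype

namespace RepairNetwork

variable {n k : ℕ}

/-- Capacities in the modified information flow graph of the repair stage, when `z a b` fragments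
are sent from `a` to `b`, every node stores `α` fragments, and the data collector is connected to
the new node and to the surviving nodes in `S`. Survivors relay, so their traffic enters their
output vertices; the new node stores at most `α` fragments of what enters its input vertex. -/
noncomputable def capacity (N : RepairNetwork n k) (α : ℕ) (z : Fin n → Fin n → ℝ≥0)
    (S : Finset (Fin n)) : FlowVertex n → FlowVertex n → ℝ≥0∞
  | .source, .input i => if i = N.failed then 0 else ⊤
  | .input i, .output j => if i = j then (α : ℝ≥0∞) else 0
  | .output i, .output j => if j = N.failed then 0 else (z i j : ℝ≥0∞)
  | .output i, .input j => if j = N.failed then (z i j : ℝ≥0∞) else 0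
  | .output i, .collector => if i ∈ S ∨ i = N.failed then ⊤ else 0
  | _, _ => 0

/-- The value of the cut with sink side `T`: total capacity of the edges entering `T`. -/
noncomputable def cutValue (N : RepairNetwork n k) (α : ℕ) (z : Fin n → Fin n → ℝ≥0)
    (S : Finset (Fin n)) (T : Finset (FlowVertex n)) : ℝ≥0∞ :=
  ∑ u ∈ Tᶜ, ∑ v ∈ T, N.capacity α z S u v

/-- The feasible region of the linear program: non-negative real vectors supported on the links,
such that for a data collector connected to the new node and any `k - 1` surviving nodes, all cuts
between the source and the collector have value at least the file size `M`. -/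
def polytope (N : RepairNetwork n k) (α M : ℕ) : Set (Fin n → Fin n → ℝ≥0) :=
  {z | (∀ a b, ¬ N.link a b → z a b = 0) ∧
    ∀ S : Finset (Fin n), N.failed ∉ S → S.card + 1 = k →
      ∀ T : Finset (FlowVertex n), FlowVertex.collector ∈ T → FlowVertex.source ∉ T →
        (M : ℝ≥0∞) ≤ N.cutValue α z S T}

/-- The objective of the linear program: the cost of the traffic `z`. -/
def repairCost (N : RepairNetwork n k) (z : Fin n → Fin n → ℝ≥0) : ℝ≥0 :=
  ∑ a, ∑ b, N.cost a b * z a b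

/-- A vector of integral link loads, as a real vector. -/
def realLoad (z : Fin n → Fin n → ℕ) : Fin n → Fin n → ℝ≥0 := fun a b => (z a b : ℝ≥0)

/-- A directed path of links that ends at the new node. A fragment that follows it is coded once at
each of its nodes, the new node included, that is `p.length` times. -/
def IsCodingPath (N : RepairNetwork n k) (p : List (Fin n)) : Prop :=
  p.IsChain N.link ∧ p.getLast? = some N.failed

end RepairNetwork

/-- The coding coefficients of all nodes: column `j` of `Q i` gives fragment `j` of node `i` as a
linear combination of the `M` source fragments. -/
abbrev StorageCode (F : Type*) (n M α : ℕ) : Type _ := Fin n → Matrix (Fin M) (Fin α) F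

/-- The regenerating code property: the contents `(Q i)ᵀ s` of any `k` nodes determine the source
file `s`. -/
def HasRCP {F : Type*} [Field F] {n M α : ℕ} (k : ℕ) (Q : StorageCode F n M α) : Prop :=
  ∀ S : Finset (Fin n), S.card = k →
    ∀ s s' : Fin M → F,
      (∀ i ∈ S, (Q i).transpose.mulVec s = (Q i).transpose.mulVec s') → s = s'

/-- A linear network code for one repair stage with new node `f`: `load a b` fragments are sent
from `a` to `b`. Fragment `t` on this link is the combination of the fragments stored at `a`
(coefficients `stored`) and of the fragments that `a` receives from all nodes `c` (coefficients
`relayed`: surviving node cooperation). The new node stores combinations of the fragments it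
receives (coefficients `final`). -/
structure RepairScheme (F : Type*) (n α : ℕ) (f : Fin n) where
  load : Fin n → Fin n → ℕ
  stored : (a b : Fin n) → Fin (load a b) → Fin α → F
  relayed : (a b : Fin n) → Fin (load a b) → (c : Fin n) → Fin (load c a) → F
  final : Fin α → (c : Fin n) → Fin (load c f) → F

/-- Running the scheme turns the code `Q` into `Q'`; here `g a b t` is the vector of coefficients,
with respect to the source fragments, of fragment `t` on the link from `a` to `b`. -/
def RepairScheme.Regenerates {F : Type*} [Field F] {n M α : ℕ} {f : Fin n}
    (R : RepairScheme F n α f) (Q Q' : StorageCode F n M α) : Prop :=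
  (∀ i, i ≠ f → Q' i = Q i) ∧
  ∃ g : (a b : Fin n) → Fin (R.load a b) → (Fin M → F),
    (∀ a b t, g a b t =
      (∑ j, R.stored a b t j • (Q a).col j) + ∑ c, ∑ u, R.relayed a b t c u • g c a u) ∧
    (∀ j, (Q' f).col j = ∑ c, ∑ u, R.final j c u • g c f u)

/-! It suffices to repair one stage while keeping the RCP; folding over the history does the rest.
In one stage the coding coefficients are indeterminates and the current code is constant, so the
bound on q does not depend on the history. For each `k`-set of nodes, reconstruction is the
non-vanishing of an `M × M` determinant with entries of degree at most `nnc`. The product of these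
determinants has degree at most `d₀ < q`, so it has a non-root as soon as no single determinant is
the zero polynomial (`exists_point_reconstructing`). Hence a good choice of coefficients is needed
only for one `k`-set at a time.

The only hard case is the new node together with a set `S` of `k - 1` survivors. Feasibility bounds
the cuts (`le_sum_entering`), and Hall's theorem turns these bounds into `α` edge-disjoint routes to
the new node, starting outside `S` (`exists_disjoint_routes`). By the RCP of `S ∪ {c}`, a starting
node `c ∉ S` can produce any vector modulo the contents of `S`, in particular the `j`-th lost
column. Forwarding these columns along the routes restores the lost node modulo `S`, and the old RCP
of `S` with the lost node applies (`exists_coefficients`). -/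

open Matrix in
/-- The regenerating code property, in terms of the vectors orthogonal to the stored columns. -/
theorem hasRCP_iff {F : Type*} [Field F] {n M α k : ℕ} (Q : StorageCode F n M α) :
    HasRCP k Q ↔ ∀ K : Finset (Fin n), K.card = k → ∀ s : Fin M → F,
      (∀ i ∈ K, ∀ j, (Q i).col j ⬝ᵥ s = 0) → s = 0 := by
  have key : ∀ i s, (Q i).transpose.mulVec s = fun j => (Q i).col j ⬝ᵥ s := fun i s => rfl
  constructor
  · intro h K hK s hs
    refine h K hK s 0 fun i hi => ?_
    rw [key, key]
    funext j
    rw [hs i hi j, dotProduct_zero]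
  · intro h K hK s s' hs
    refine sub_eq_zero.mp (h K hK (s - s') fun i hi j => ?_)
    have := congrFun (hs i hi) j
    rw [key, key] at this
    rw [dotProduct_sub, sub_eq_zero]
    exact this

/-! ### Determinants, degrees and the field size -/

/-- The total degree of a determinant is at most the dimension times the degree of the entries. -/
theorem totalDegree_det_le {σ R : Type*} [CommRing R] {m : ℕ}
    (A : Matrix (Fin m) (Fin m) (MvPolynomial σ R)) (d : ℕ)
    (hA : ∀ i j, (A i j).totalDegree ≤ d) : A.det.totalDegree ≤ m * d := by
  rw [Matrix.det_apply]
  refine MvPolynomial.totalDegree_finsetSum_le fun τ _ => ?_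
  have h1 : (∏ i, A (τ i) i).totalDegree ≤ m * d := by
    refine (MvPolynomial.totalDegree_finsetProd _ _).trans ?_
    refine (Finset.sum_le_card_nsmul _ _ d fun i _ => hA _ _).trans ?_
    simp
  rcases Int.units_eq_one_or (Equiv.Perm.sign τ) with h | h
  · rw [h, one_smul]; exact h1
  · rw [h, Units.neg_smul, one_smul, MvPolynomial.totalDegree_neg]; exact h1

/-- A polynomial whose total degree is smaller than the field has a point where it is nonzero. -/
theorem exists_eval_ne_zero_of_totalDegree_lt {σ F : Type*} [Finite σ] [Field F] [Fintype F]
    (P : MvPolynomial σ F) (hP : P ≠ 0) (hdeg : P.totalDegree < Fintype.card F) :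
    ∃ x : σ → F, MvPolynomial.eval x P ≠ 0 := by
  by_contra! h
  refine hP (MvPolynomial.eq_zero_of_eval_zero_at_prod_finset P (fun _ => Finset.univ) ?_
    fun x _ => h x)
  intro i
  exact (MvPolynomial.degreeOf_le_totalDegree P i).trans_lt hdeg

open Matrix in
/-- A code with polynomial entries of degree at most `d` has the reconstruction property at some
point, if for each `k`-subset of nodes there is a point at which this subset determines the
file. -/
theorem exists_point_reconstructing {σ F : Type*} [Finite σ] [Field F] [Fintype F]
    {n k α M d : ℕ} (hM : M = k * α)
    (P : Fin n → Fin α → Fin M → MvPolynomial σ F)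
    (hdeg : ∀ i j r, (P i j r).totalDegree ≤ d)
    (hq : n.choose k * M * d < Fintype.card F)
    (hpt : ∀ K : Finset (Fin n), K.card = k → ∃ x : σ → F, ∀ s : Fin M → F,
      (∀ i ∈ K, ∀ j, (fun r => MvPolynomial.eval x (P i j r)) ⬝ᵥ s = 0) → s = 0) :
    ∃ x : σ → F, ∀ K : Finset (Fin n), K.card = k → ∀ s : Fin M → F,
      (∀ i ∈ K, ∀ j, (fun r => MvPolynomial.eval x (P i j r)) ⬝ᵥ s = 0) → s = 0 := by
  classical
  have hidx : ∀ K : Finset (Fin n), K.card = k → Nonempty (Fin M ≃ K × Fin α) := by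
    intro K hK
    refine ⟨Fintype.equivOfCardEq ?_⟩
    simp [hK, hM]
  -- The matrix stacks the fragments of `K`; it is square because `M = k * α`. Sets of another size
  -- get the dummy value 0, so that `choose` yields a total function.
  have hmat : ∀ K : Finset (Fin n), ∃ A : Matrix (Fin M) (Fin M) (MvPolynomial σ F),
      (∀ i j, (A i j).totalDegree ≤ d) ∧ (K.card = k → ∀ x : σ → F,
        MvPolynomial.eval x A.det ≠ 0 ↔ ∀ s : Fin M → F,
          (∀ i ∈ K, ∀ j, (fun r => MvPolynomial.eval x (P i j r)) ⬝ᵥ s = 0) → s = 0) := by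
    intro K
    by_cases hK : K.card = k
    · obtain ⟨e⟩ := hidx K hK
      refine ⟨Matrix.of fun t r => P (e t).1 (e t).2 r, fun t r => hdeg _ _ _, fun _ x => ?_⟩
      rw [RingHom.map_det, Ne, ← Matrix.exists_mulVec_eq_zero_iff]
      push Not
      have hker : ∀ s : Fin M → F,
          ((MvPolynomial.eval x).mapMatrix (Matrix.of fun t r => P (e t).1 (e t).2 r)) *ᵥ s = 0 ↔
          ∀ i ∈ K, ∀ j, (fun r => MvPolynomial.eval x (P i j r)) ⬝ᵥ s = 0 := by
        intro s
        constructor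
        · intro h i hi j
          have := congrFun h (e.symm (⟨i, hi⟩, j))
          simpa [Matrix.mulVec, dotProduct] using this
        · intro h
          funext t
          have := h (e t).1 (e t).1.2 (e t).2
          simpa [Matrix.mulVec, dotProduct] using this
      constructor
      · intro h s hs
        by_contra hne
        exact h s hne ((hker s).2 hs)
      · intro h s hne hs
        exact hne (h s ((hker s).1 hs))
    · exact ⟨0, fun i j => by simp, fun h => absurd h hK⟩
  choose A hAdeg hA using hmat
  obtain ⟨x, hx⟩ := exists_eval_ne_zero_of_totalDegree_lt
    (∏ K ∈ Finset.powersetCard k (Finset.univ : Finset (Fin n)), (A K).det) (by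
      rw [Finset.prod_ne_zero_iff]
      intro K hK h0
      have hK' := (Finset.mem_powersetCard.1 hK).2
      obtain ⟨x, hx⟩ := hpt K hK'
      exact (hA K hK' x).2 hx (by rw [h0, map_zero])) (by
      refine lt_of_le_of_lt ?_ hq
      refine (MvPolynomial.totalDegree_finsetProd _ _).trans ?_
      refine (Finset.sum_le_card_nsmul _ _ (M * d)
        fun K _ => totalDegree_det_le _ d (hAdeg K)).trans ?_
      simp [mul_assoc])
  refine ⟨x, fun K hK => (hA K hK x).1 fun h0 => hx ?_⟩
  rw [map_prod]
  exact Finset.prod_eq_zero (Finset.mem_powersetCard.2 ⟨Finset.subset_univ _, hK⟩) h0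

open Matrix in
/-- Over a large enough field there is a code with the regenerating code property. -/
theorem exists_hasRCP {F : Type*} [Field F] [Fintype F] {n k α M : ℕ} (hM : M = k * α)
    (hq : n.choose k * M < Fintype.card F) : ∃ Q : StorageCode F n M α, HasRCP k Q := by
  classical
  obtain ⟨x, hx⟩ := exists_point_reconstructing (σ := Fin n × Fin α × Fin M) (F := F) (n := n)
    (d := 1) hM (fun i j r => MvPolynomial.X (i, j, r)) (fun i j r => by simp)
    (by simpa using hq) (by
      intro K hK
      have e : Fin M ≃ K × Fin α := Fintype.equivOfCardEq (by simp [hK, hM])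
      -- The nodes of `K` store the `M` source fragments uncoded, one each along `e`.
      refine ⟨fun p => if h : p.1 ∈ K then (if p.2.2 = e.symm (⟨p.1, h⟩, p.2.1) then 1 else 0)
        else 0, fun s hs => ?_⟩
      funext r
      have := hs (e r).1 (e r).1.2 (e r).2
      simpa [dotProduct] using this)
  refine ⟨fun i => Matrix.of fun r j => x (i, j, r), (hasRCP_iff _).2 fun K hK s hs => ?_⟩
  refine hx K hK s fun i hi j => ?_
  simpa [Matrix.col, dotProduct] using hs i hi j

/-! ### Linear algebra modulo the contents of a set of nodes -/

open Matrix in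
/-- Modulo the contents of `S`, every vector is a combination of the columns of any matrix that
together with the contents of `S` determines the file. -/
theorem exists_combination_modulo {F : Type*} [Field F] {n M α : ℕ} (Q : StorageCode F n M α)
    (S : Finset (Fin n)) (c : Fin n)
    (h : ∀ s : Fin M → F, (∀ i ∈ S, ∀ j, (Q i).col j ⬝ᵥ s = 0) →
      (∀ j, (Q c).col j ⬝ᵥ s = 0) → s = 0) (v : Fin M → F) :
    ∃ β : Fin α → F, ∀ s : Fin M → F, (∀ i ∈ S, ∀ j, (Q i).col j ⬝ᵥ s = 0) →
      (∑ t, β t • (Q c).col t) ⬝ᵥ s = v ⬝ᵥ s := by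
  let W : Submodule F (Fin M → F) :=
    { carrier := {s | ∀ i ∈ S, ∀ j, (Q i).col j ⬝ᵥ s = 0}
      add_mem' := fun {a b} ha hb i hi j => by rw [dotProduct_add, ha i hi j, hb i hi j, add_zero]
      zero_mem' := fun i _ j => dotProduct_zero _
      smul_mem' := fun r a ha i hi j => by rw [dotProduct_smul, ha i hi j, smul_zero] }
  let L : W →ₗ[F] (Fin α → F) := (Matrix.mulVecLin (Q c)ᵀ).comp W.subtype
  have hL : ∀ (s : W) j, L s j = (Q c).col j ⬝ᵥ (s : Fin M → F) := fun s j => rfl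
  have hker : LinearMap.ker L = ⊥ := by
    rw [LinearMap.ker_eq_bot']
    intro s hs
    refine Subtype.ext (h s s.2 fun j => ?_)
    rw [← hL, hs]; rfl
  obtain ⟨G, hG⟩ := L.exists_leftInverse_of_injective hker
  -- On `W` the functional `v` factors through the injective map `L` as `v ∘ G ∘ L`; the
  -- coefficients are the values of `v ∘ G` on the unit vectors.
  refine ⟨fun t => v ⬝ᵥ (G (Pi.single t 1) : Fin M → F), fun s hs => ?_⟩
  have h1 : G (L ⟨s, hs⟩) = ⟨s, hs⟩ := LinearMap.congr_fun hG _
  have h2 : L ⟨s, hs⟩ = ∑ t, L ⟨s, hs⟩ t • (Pi.single t 1 : Fin α → F) := by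
    rw [← pi_eq_sum_univ' (L ⟨s, hs⟩)]
  have h3 : s = ∑ t, ((Q c).col t ⬝ᵥ s) • (G (Pi.single t 1) : Fin M → F) := by
    have := congrArg (Subtype.val) h1
    rw [h2, map_sum] at this
    simp only [map_smul, Submodule.coe_sum, Submodule.coe_smul, hL] at this
    exact this.symm
  conv_rhs => rw [h3]
  rw [sum_dotProduct, dotProduct_sum]
  refine Finset.sum_congr rfl fun t _ => ?_
  rw [smul_dotProduct, dotProduct_smul, smul_eq_mul, smul_eq_mul, mul_comm]

/-! ### Cuts of the information flow graph -/

namespace FlowVertex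

/-- Sums over the vertices of the information flow graph. -/
theorem sum_eq {n : ℕ} {A : Type*} [AddCommMonoid A] (φ : FlowVertex n → A) :
    ∑ v, φ v = φ source + ∑ i, φ (input i) + ∑ i, φ (output i) + φ collector := by
  let e : (Unit ⊕ Fin n) ⊕ (Fin n ⊕ Unit) ≃ FlowVertex n :=
    { toFun := fun x => match x with
        | .inl (.inl _) => source
        | .inl (.inr i) => input i
        | .inr (.inl i) => output i
        | .inr (.inr _) => collector
      invFun := fun v => match v with
        | source => .inl (.inl ())
        | input i => .inl (.inr i)
        | output i => .inr (.inl i)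
        | collector => .inr (.inr ())
      left_inv := by rintro ((_ | _) | (_ | _)) <;> rfl
      right_inv := by rintro (_ | _ | _ | _) <;> rfl }
  rw [← e.sum_comp φ]
  simp [Fintype.sum_sum_type, e, add_assoc]

end FlowVertex

namespace RepairNetwork

variable {n k : ℕ}

/-- Allows induction from upstream nodes to downstream nodes; fragments, degrees and routes are all
handled this way. -/
theorem link_wellFounded (N : RepairNetwork n k) : WellFounded N.link := by
  have : Std.Irrefl (Relation.TransGen N.link) := ⟨N.acyclic⟩
  have : IsTrans (Fin n) (Relation.TransGen N.link) := ⟨fun _ _ _ => Relation.TransGen.trans⟩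
  exact Subrelation.wf (fun h => Relation.TransGen.single h)
    (Finite.wellFounded_of_trans_of_irrefl (Relation.TransGen N.link))

/-- The links that enter `A` or the new node from outside `A`. -/
def entering (N : RepairNetwork n k) (A : Finset (Fin n)) : Finset (Fin n × Fin n) :=
  {p | p.1 ∉ A ∧ (p.2 ∈ A ∨ p.2 = N.failed)}

/-- A feasible integral subgraph sends at least `α` fragments into the new node and any `k - 1`
surviving nodes. -/
theorem le_sum_entering_of_card_eq (N : RepairNetwork n k) {α M : ℕ} (hM : M = k * α)
    {z : Fin n → Fin n → ℕ} (hz : realLoad z ∈ N.polytope α M) {A : Finset (Fin n)}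
    (hA : N.failed ∉ A) (hcard : A.card + 1 = k) :
    α ≤ ∑ p ∈ N.entering A, z p.1 p.2 := by
  classical
  -- The inputs of `A` stay on the source side. The cut then avoids all infinite edges, and each
  -- node of `A` contributes `α`, which leaves `kα - (k - 1)α = α` for the links.
  let T : Finset (FlowVertex n) := Finset.univ.filter fun v => match v with
    | .source => False
    | .input i => i = N.failed
    | .output i => i ∈ A ∨ i = N.failed
    | .collector => True
  have hcut := hz.2 A hA hcard T (by simp [T]) (by simp [T])
  have hval : N.cutValue α (realLoad z) A T ≤
      ((A.card * α + ∑ p ∈ N.entering A, z p.1 p.2 : ℕ) : ℝ≥0∞) := by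
    have hle : N.cutValue α (realLoad z) A T = ∑ u, ∑ v,
        if u ∉ T ∧ v ∈ T then N.capacity α (realLoad z) A u v else 0 := by
      rw [cutValue, ← Finset.sum_filter_add_sum_filter_not Finset.univ (fun u => u ∉ T)]
      rw [Finset.sum_eq_zero (s := Finset.univ.filter fun u => ¬ u ∉ T), add_zero]
      · refine Finset.sum_congr (by ext; simp) fun u hu => ?_
        have hu : u ∉ T := by simpa using hu
        simp [hu, Finset.sum_ite_mem]
      · intro u hu
        have hu : u ∈ T := by simpa using hu
        simp [hu]
    rw [hle]
    simp only [FlowVertex.sum_eq, T, Finset.mem_filter, Finset.mem_univ, true_and, capacity]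
    simp only [not_or, not_false_eq_true, and_true, true_and, not_true_eq_false,
      false_and, and_false, zero_add, add_zero, Finset.sum_const_zero, ite_self]
    have hA' : ∀ x ∈ A, x ≠ N.failed := fun x hx h => hA (h ▸ hx)
    have hsum : ∑ p ∈ N.entering A, z p.1 p.2 =
        ∑ a, ∑ b, if a ∉ A ∧ (b ∈ A ∨ b = N.failed) then z a b else 0 := by
      rw [entering, Finset.sum_filter, Fintype.sum_prod_type]
    rw [hsum, Nat.cast_add, Nat.cast_mul, Nat.cast_sum]
    refine add_le_add ?_ (Finset.sum_le_sum fun a _ => ?_)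
    · rw [Finset.sum_eq_zero, zero_add]
      · calc _ ≤ ∑ x, if x ∈ A then (α : ℝ≥0∞) else 0 := by
              refine Finset.sum_le_sum fun x _ => ?_
              rw [Finset.sum_eq_single x]
              · split_ifs with h1 h2 <;> simp_all
              · intro y _ hy
                simp [hy.symm]
              · simp
          _ = _ := by simp
      · intro x _
        split_ifs <;> rfl
    · have hlast : (if a ∉ A ∧ ¬a = N.failed then
          if a ∈ A ∨ a = N.failed then (⊤ : ℝ≥0∞) else 0 else 0) = 0 := by
        split_ifs <;> simp_all
      rw [hlast, add_zero, ← Finset.sum_add_distrib, Nat.cast_sum]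
      refine Finset.sum_le_sum fun b _ => ?_
      by_cases hb : b = N.failed
      · by_cases ha : a ∉ A ∧ ¬ a = N.failed
        · simp [hb, ha.1, ha.2, realLoad]
        · simp [hb, ha]
      · by_cases ha : a ∉ A ∧ ¬ a = N.failed
        · simp [hb, ha.1, ha.2, realLoad]
        · simp [hb, ha]
  have h2 : ((k * α : ℕ) : ℝ≥0∞) ≤ ((A.card * α + ∑ p ∈ N.entering A, z p.1 p.2 : ℕ) : ℝ≥0∞) :=
    hM ▸ hcut.trans hval
  have h3 : k * α ≤ A.card * α + ∑ p ∈ N.entering A, z p.1 p.2 := by exact_mod_cast h2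
  have h4 : k * α = A.card * α + α := by rw [← hcard, add_mul, one_mul]
  omega

/-- A feasible integral subgraph sends at least `α` fragments into the new node and any fewer than
`k` surviving nodes. -/
theorem le_sum_entering (N : RepairNetwork n k) {α M : ℕ} (hM : M = k * α)
    {z : Fin n → Fin n → ℕ} (hz : realLoad z ∈ N.polytope α M) {A : Finset (Fin n)}
    (hA : N.failed ∉ A) (hcard : A.card + 1 ≤ k) :
    α ≤ ∑ p ∈ N.entering A, z p.1 p.2 := by
  classical
  obtain ⟨m, hm⟩ := Nat.exists_eq_add_of_le hcard
  induction m generalizing A with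
  | zero => exact N.le_sum_entering_of_card_eq hM hz hA hm.symm
  | succ m ih =>
    have hlink : ∀ a b, z a b ≠ 0 → N.link a b := by
      intro a b hab
      by_contra h
      exact hab (by simpa [realLoad] using hz.1 a b h)
    -- Enlarge `A` by a most upstream survivor `c` outside it. No link reaches `c` from outside `A`,
    -- so every loaded link that enters the larger set already entered the old one.
    obtain ⟨c, hc, hmin⟩ := N.link_wellFounded.has_min {c | c ∉ A ∧ c ≠ N.failed} (by
      by_contra hne
      rw [Set.not_nonempty_iff_eq_empty] at hne
      have hsub : N.helpers ⊆ A := by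
        intro c hc
        by_contra hcA
        have : c ∈ {c | c ∉ A ∧ c ≠ N.failed} :=
          ⟨hcA, fun h => N.failed_notMem (h ▸ hc)⟩
        rw [hne] at this
        exact this
      have := Finset.card_le_card hsub
      have := N.le_card_helpers
      omega)
    have hfc : N.failed ∉ insert c A := by
      rw [Finset.mem_insert, not_or]
      exact ⟨fun h => hc.2 h.symm, hA⟩
    have hcc : (insert c A).card = A.card + 1 := Finset.card_insert_of_notMem hc.1
    refine (ih hfc (by omega) (by omega)).trans ?_
    refine Finset.sum_le_sum_of_ne_zero fun p hp hp0 => ?_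
    have hl := hlink _ _ hp0
    simp only [entering, Finset.mem_filter, Finset.mem_univ, true_and, Finset.mem_insert,
      not_or] at hp ⊢
    refine ⟨hp.1.2, ?_⟩
    rcases hp.2 with (h | h) | h
    · have hpf : p.1 ≠ N.failed := fun h => N.failed_notMem (h ▸ N.tail_mem _ _ hl)
      exact absurd (h ▸ hl) (hmin p.1 ⟨hp.1.2, hpf⟩)
    · exact Or.inl h
    · exact Or.inr h

end RepairNetwork

/-! ### Edge-disjoint routes from Hall's theorem -/

/-- The unit-capacity edges of a subgraph: edge `⟨(a, b), t⟩` carries fragment `t` from `a` to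
`b`. -/
abbrev UnitEdge {n : ℕ} (z : Fin n → Fin n → ℕ) : Type := Σ p : Fin n × Fin n, Fin (z p.1 p.2)

/-- The elements on route `j` of an assignment `m`, which maps the end of each route to its last
edge, and edges with tail in `S` to their predecessors. -/
inductive OnRoute {n α : ℕ} {z : Fin n → Fin n → ℕ} {S : Finset (Fin n)}
    (m : {e : UnitEdge z // e.1.1 ∈ S} ⊕ Fin α → UnitEdge z) (j : Fin α) :
    {e : UnitEdge z // e.1.1 ∈ S} ⊕ Fin α → Prop
  | last : OnRoute m j (Sum.inr j)
  | pred {x : {e : UnitEdge z // e.1.1 ∈ S} ⊕ Fin α} {e : {e : UnitEdge z // e.1.1 ∈ S}} :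
      OnRoute m j x → m x = e.1 → OnRoute m j (Sum.inl e)

namespace OnRoute

variable {n α : ℕ} {z : Fin n → Fin n → ℕ} {S : Finset (Fin n)}
  {m : {e : UnitEdge z // e.1.1 ∈ S} ⊕ Fin α → UnitEdge z}

/-- By injectivity of `m`, a route can be traced back to its end in only one way. -/
theorem unique (hm : Function.Injective m) {j j' : Fin α}
    {x : {e : UnitEdge z // e.1.1 ∈ S} ⊕ Fin α} (h : OnRoute m j x) (h' : OnRoute m j' x) :
    j = j' := by
  induction h with
  | last => cases h'; rfl
  | pred hx he ih =>
    cases h' with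
    | pred hx' he' =>
      have := hm (he.trans he'.symm)
      subst this
      exact ih hx'

/-- A self-assigned edge on a route would, by injectivity, be its own successor, so tracing back
would never arrive at the route end. -/
theorem ne_self (hm : Function.Injective m) {j : Fin α}
    {x : {e : UnitEdge z // e.1.1 ∈ S} ⊕ Fin α} (h : OnRoute m j x) :
    ∀ e, x = Sum.inl e → m x ≠ e.1 := by
  induction h with
  | last => intro e he; cases he
  | @pred x' e' hx he ih =>
    intro e hee
    cases hee
    intro hself
    have hxe := hm (he.trans hself.symm)
    exact ih e' hxe he

end OnRoute

namespace RepairNetwork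

variable {n k : ℕ}

open Finset in
/-- If every set of relays can receive `α` fragments together with the new node, then the relay
edges and the `α` route ends can be assigned distinct edges that precede them. Relay edges that are
not needed are assigned to themselves. -/
theorem exists_predecessors (N : RepairNetwork n k) {α : ℕ} (z : Fin n → Fin n → ℕ)
    (S : Finset (Fin n)) (hS : ∀ A ⊆ S, α ≤ ∑ p ∈ N.entering A, z p.1 p.2) :
    ∃ m : {e : UnitEdge z // e.1.1 ∈ S} ⊕ Fin α → UnitEdge z, Function.Injective m ∧
      (∀ e, m (Sum.inl e) = e.1 ∨ (m (Sum.inl e)).1.2 = e.1.1.1) ∧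
      ∀ j, (m (Sum.inr j)).1.2 = N.failed := by
  classical
  let t : {e : UnitEdge z // e.1.1 ∈ S} ⊕ Fin α → Finset (UnitEdge z) := fun x => match x with
    | .inl e => univ.filter fun e' => e' = e.1 ∨ e'.1.2 = e.1.1.1
    | .inr _ => univ.filter fun e' => e'.1.2 = N.failed
  obtain ⟨m, hm, hmt⟩ := (Finset.all_card_le_biUnion_card_iff_exists_injective t).1 (by
    intro W
    let R : Finset (UnitEdge z) := W.toLeft.map (Function.Embedding.subtype _)
    let A : Finset (Fin n) := R.image fun e => e.1.1
    have hRsub : R ⊆ W.biUnion t := by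
      intro e he
      obtain ⟨e', he', rfl⟩ := mem_map.1 he
      exact mem_biUnion.2 ⟨Sum.inl e', mem_toLeft.1 he', by simp [t]⟩
    have hRcard : R.card = W.toLeft.card := card_map _
    have hWcard : W.toLeft.card + W.toRight.card = W.card := card_toLeft_add_card_toRight
    rcases W.toRight.eq_empty_or_nonempty with h0 | ⟨j, hj⟩
    · rw [h0, card_empty] at hWcard
      rw [← hWcard, add_zero, ← hRcard]
      exact card_le_card hRsub
    -- All route ends have the same candidates, so one end in `W` already supplies every edge into
    -- the new node. Edges of `R` have their tails in `A` and edges of `In` do not, so there are at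
    -- least `R.card + α` candidates.
    · let In : Finset (UnitEdge z) := (N.entering A).sigma fun p => univ
      have hInSub : In ⊆ W.biUnion t := by
        intro e he
        have he' := (mem_sigma.1 he).1
        simp only [entering, mem_filter, mem_univ, true_and] at he'
        rcases he'.2 with h | h
        · obtain ⟨r, hr, hre⟩ := mem_image.1 h
          obtain ⟨e', he', rfl⟩ := mem_map.1 hr
          refine mem_biUnion.2 ⟨Sum.inl e', mem_toLeft.1 he', ?_⟩
          simp only [t, mem_filter, mem_univ, true_and]
          exact Or.inr hre.symm
        · exact mem_biUnion.2 ⟨Sum.inr j, mem_toRight.1 hj, by simp [t, h]⟩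
      have hInCard : α ≤ In.card := by
        rw [card_sigma]
        simpa using hS A (by
          intro a ha
          obtain ⟨r, hr, rfl⟩ := mem_image.1 ha
          obtain ⟨e', -, rfl⟩ := mem_map.1 hr
          exact e'.2)
      have hdisj : Disjoint R In := by
        rw [disjoint_left]
        intro e heR heI
        have he' := (mem_sigma.1 heI).1
        simp only [entering, mem_filter, mem_univ, true_and] at he'
        exact he'.1 (mem_image_of_mem _ heR)
      have hright : W.toRight.card ≤ α := (card_le_univ _).trans (by simp)
      have := card_le_card (union_subset hRsub hInSub)
      rw [card_union_of_disjoint hdisj] at this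
      omega)
  refine ⟨m, hm, fun e => ?_, fun j => ?_⟩
  · simpa [t] using hmt (Sum.inl e)
  · simpa [t] using hmt (Sum.inr j)

/-- If every set of relays can receive `α` fragments together with the new node, then there are `α`
disjoint routes of unit edges to the new node that start outside the set of relays: `lab` marks the
edges of the routes, `last` gives their last edges and `pred` the predecessors of their edges. -/
theorem exists_disjoint_routes (N : RepairNetwork n k) {α : ℕ} (z : Fin n → Fin n → ℕ)
    (S : Finset (Fin n)) (hS : ∀ A ⊆ S, α ≤ ∑ p ∈ N.entering A, z p.1 p.2) :
    ∃ (lab : UnitEdge z → Option (Fin α)) (last : Fin α → UnitEdge z)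
      (pred : UnitEdge z → UnitEdge z),
      (∀ j, (last j).1.2 = N.failed ∧ lab (last j) = some j) ∧
      ∀ e j, lab e = some j → e.1.1 ∈ S → (pred e).1.2 = e.1.1 ∧ lab (pred e) = some j := by
  classical
  obtain ⟨m, hm, hrelay, hlast⟩ := N.exists_predecessors z S hS
  have huniq : ∀ e j j', (∃ x, OnRoute m j x ∧ m x = e) → (∃ x, OnRoute m j' x ∧ m x = e) →
      j = j' := by
    rintro e j j' ⟨x, hx, hxe⟩ ⟨y, hy, hye⟩
    have := hm (hxe.trans hye.symm)
    subst this
    exact hx.unique hm hy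
  let lab : UnitEdge z → Option (Fin α) := fun e =>
    if h : ∃ j x, OnRoute m j x ∧ m x = e then some h.choose else none
  have hlab : ∀ e j, lab e = some j ↔ ∃ x, OnRoute m j x ∧ m x = e := by
    intro e j
    simp only [lab]
    split_ifs with h
    · rw [Option.some_inj]
      exact ⟨fun hj => hj ▸ h.choose_spec, fun hj => huniq e _ _ h.choose_spec hj⟩
    · simp only [false_iff]
      exact fun hj => h ⟨j, hj⟩
  -- The value `e` of the predecessor map outside `S` is a dummy: routes start there.
  refine ⟨lab, fun j => m (Sum.inr j),
    fun e => if h : e.1.1 ∈ S then m (Sum.inl ⟨e, h⟩) else e, fun j => ⟨hlast j, ?_⟩, ?_⟩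
  · exact (hlab _ _).2 ⟨_, .last, rfl⟩
  · intro e j he heS
    obtain ⟨x, hx, hxe⟩ := (hlab _ _).1 he
    have hon : OnRoute m j (Sum.inl ⟨e, heS⟩) := .pred hx hxe
    simp only [heS, dif_pos]
    exact ⟨(hrelay ⟨e, heS⟩).resolve_left (hon.ne_self hm _ rfl), (hlab _ _).2 ⟨_, hon, rfl⟩⟩

/-! ### Good coefficients for one set of nodes -/

open Matrix in
/-- Given routes as in `exists_disjoint_routes`, forwarding along them yields coding coefficients
with which the contents of `S` and of the new node determine the file. -/
theorem exists_coefficients (N : RepairNetwork n k) {F : Type*} [Field F] {M α : ℕ}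
    {z : Fin n → Fin n → ℕ} (hlink : ∀ a b, z a b ≠ 0 → N.link a b)
    {Q : StorageCode F n M α} (hQ : HasRCP k Q)
    {S : Finset (Fin n)} (hf : N.failed ∉ S) (hcard : S.card + 1 = k)
    (hS : ∀ A ⊆ S, α ≤ ∑ p ∈ N.entering A, z p.1 p.2) :
    ∃ (stored : (a b : Fin n) → Fin (z a b) → Fin α → F)
      (relayed : (a b : Fin n) → Fin (z a b) → (c : Fin n) → Fin (z c a) → F)
      (final : Fin α → (c : Fin n) → Fin (z c N.failed) → F),
      ∀ g : (a b : Fin n) → Fin (z a b) → (Fin M → F),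
        (∀ a b t, g a b t = (∑ j, stored a b t j • (Q a).col j) +
          ∑ c, ∑ u, relayed a b t c u • g c a u) →
        ∀ s : Fin M → F, (∀ i ∈ S, ∀ j, (Q i).col j ⬝ᵥ s = 0) →
          (∀ j, (∑ c, ∑ u, final j c u • g c N.failed u) ⬝ᵥ s = 0) → s = 0 := by
  classical
  obtain ⟨lab, last, pred, hlast, hpred⟩ := N.exists_disjoint_routes z S hS
  have hdet : ∀ c, c ∉ S → ∀ s : Fin M → F, (∀ i ∈ S, ∀ j, (Q i).col j ⬝ᵥ s = 0) →
      (∀ j, (Q c).col j ⬝ᵥ s = 0) → s = 0 := by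
    intro c hc s hs hcs
    refine (hasRCP_iff Q).1 hQ (insert c S) (by rw [Finset.card_insert_of_notMem hc, hcard]) s ?_
    intro i hi j
    rcases Finset.mem_insert.1 hi with rfl | hi
    · exact hcs j
    · exact hs i hi j
  have hcomb : ∀ (c : Fin n) (j : Fin α), ∃ β : Fin α → F, c ∉ S → ∀ s : Fin M → F,
      (∀ i ∈ S, ∀ j, (Q i).col j ⬝ᵥ s = 0) →
      (∑ t, β t • (Q c).col t) ⬝ᵥ s = (Q N.failed).col j ⬝ᵥ s := by
    intro c j
    by_cases hc : c ∈ S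
    · exact ⟨0, fun h => absurd hc h⟩
    · obtain ⟨β, hβ⟩ := exists_combination_modulo Q S c (hdet c hc) ((Q N.failed).col j)
      exact ⟨β, fun _ => hβ⟩
  choose β hβ using hcomb
  -- Nodes outside `S` code only their own contents, nodes of `S` only forward the preceding
  -- fragment, and unlabelled edges leaving nodes outside `S` carry 0.
  refine ⟨fun a b t => if a ∈ S then 0 else ((lab ⟨(a, b), t⟩).map (β a)).getD 0,
    fun a b t c u => if a ∈ S ∧ (⟨(c, a), u⟩ : UnitEdge z) = pred ⟨(a, b), t⟩ then 1 else 0,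
    fun j c u => if (⟨(c, N.failed), u⟩ : UnitEdge z) = last j then 1 else 0, ?_⟩
  intro g hg s hs hfin
  have hpick : ∀ (e : UnitEdge z) (a : Fin n), e.1.2 = a →
      ∑ c, ∑ u : Fin (z c a), (if (⟨(c, a), u⟩ : UnitEdge z) = e then (1 : F) else 0) • g c a u =
        g e.1.1 e.1.2 e.2 := by
    rintro ⟨⟨c, a⟩, u⟩ _ rfl
    rw [Finset.sum_eq_single c, Finset.sum_eq_single u]
    · simp
    · intro u' _ hu'
      simp [hu']
    · simp
    · intro c' _ hc'
      refine Finset.sum_eq_zero fun u' _ => ?_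
      rw [if_neg, zero_smul]
      intro h
      exact hc' (congrArg (fun e : UnitEdge z => e.1.1) h)
    · simp
  -- Modulo the contents of `S`, every edge of route `j` carries the `j`-th column of the lost node.
  have hmain : ∀ a b t j, lab ⟨(a, b), t⟩ = some j →
      g a b t ⬝ᵥ s = (Q N.failed).col j ⬝ᵥ s := by
    intro a
    induction a using N.link_wellFounded.induction with
    | _ a ih =>
      intro b t j hj
      rw [hg]
      by_cases ha : a ∈ S
      · obtain ⟨hhead, hl⟩ := hpred _ _ hj ha
        simp only [ha, if_true, true_and, Pi.zero_apply, zero_smul, Finset.sum_const_zero,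
          zero_add]
        rw [hpick _ a hhead]
        refine ih _ ?_ _ _ j hl
        have := hlink _ _ (Fin.pos (pred ⟨(a, b), t⟩).2).ne'
        rwa [hhead] at this
      · simp only [ha, if_false, false_and, zero_smul, Finset.sum_const_zero, add_zero, hj,
          Option.map_some, Option.getD_some]
        exact hβ a j ha s hs
  refine hdet N.failed hf s hs fun j => ?_
  have h1 := hfin j
  rw [hpick _ _ (hlast j).1, hmain _ _ _ j (hlast j).2] at h1
  exact h1

end RepairNetwork

/-! ### Generic coefficients and the repair of one stage -/

/-- The coding coefficients of a repair: one variable for each fragment on a link and each fragment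
stored at its tail, for each fragment on a link and each fragment received by its tail, and for
each fragment of the new node and each fragment received by it. -/
abbrev CodingVar {n : ℕ} (α : ℕ) (z : Fin n → Fin n → ℕ) (f : Fin n) : Type :=
  (Σ a b, Fin (z a b) × Fin α) ⊕ (Σ a b, Fin (z a b) × (Σ c, Fin (z c a))) ⊕
    (Fin α × (Σ c, Fin (z c f)))

namespace RepairNetwork

variable {n k : ℕ}

/-- In an acyclic network, the coefficient vectors of the transmitted fragments exist. -/
theorem exists_transmitted (N : RepairNetwork n k) {R V : Type*} [AddCommMonoid V] [SMul R V]
    {z : Fin n → Fin n → ℕ} (hlink : ∀ a b, z a b ≠ 0 → N.link a b)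
    (own : (a b : Fin n) → Fin (z a b) → V)
    (relayed : (a b : Fin n) → Fin (z a b) → (c : Fin n) → Fin (z c a) → R) :
    ∃ g : (a b : Fin n) → Fin (z a b) → V, ∀ a b t,
      g a b t = own a b t + ∑ c, ∑ u, relayed a b t c u • g c a u := by
  -- An index `u` shows that the load is nonzero, hence that there is a link along which to recurse.
  refine ⟨N.link_wellFounded.fix fun a ih b t => own a b t +
    ∑ c, ∑ u, relayed a b t c u • ih c (hlink c a (Fin.pos u).ne') a u, fun a b t => ?_⟩
  rw [WellFounded.fix_eq]

open MvPolynomial in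
/-- Along a coding path of the network, the degree in the coding coefficients grows by at most one
at each node. -/
theorem totalDegree_transmitted_add_le (N : RepairNetwork n k) {F σ : Type*} [Field F] {M α : ℕ}
    {z : Fin n → Fin n → ℕ} (hlink : ∀ a b, z a b ≠ 0 → N.link a b) {d : ℕ}
    (hd : ∀ p, N.IsCodingPath p → p.length ≤ d) (Q : StorageCode F n M α)
    (stored : (a b : Fin n) → Fin (z a b) → Fin α → σ)
    (relayed : (a b : Fin n) → Fin (z a b) → (c : Fin n) → Fin (z c a) → σ)
    (g : (a b : Fin n) → Fin (z a b) → Fin M → MvPolynomial σ F)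
    (hg : ∀ a b t, g a b t =
      (fun r => ∑ j, X (stored a b t j) * C (Q a r j)) +
        ∑ c, ∑ u, (X (relayed a b t c u) : MvPolynomial σ F) • g c a u)
    (a b : Fin n) (t : Fin (z a b)) (r : Fin M) (p : List (Fin n))
    (hp : N.IsCodingPath (a :: b :: p)) :
    (g a b t r).totalDegree + (b :: p).length ≤ d := by
  induction a using N.link_wellFounded.induction generalizing b p with
  | _ a ih =>
    -- Leaves room for the one variable contributed at `a`, and keeps the subtraction below from
    -- truncating.
    have hlen : 1 + (b :: p).length ≤ d := by
      have := hd _ hp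
      rw [List.length_cons] at this
      omega
    suffices h : (g a b t r).totalDegree ≤ d - (b :: p).length by omega
    have hgr : g a b t r = (∑ j, X (stored a b t j) * C (Q a r j)) +
        ∑ c, ∑ u, X (relayed a b t c u) * g c a u r := by
      rw [hg]
      simp [Finset.sum_apply]
    rw [hgr]
    refine (totalDegree_add _ _).trans (max_le ?_ ?_)
    · refine totalDegree_finsetSum_le fun j _ => (totalDegree_mul _ _).trans ?_
      rw [totalDegree_X, totalDegree_C]
      omega
    · refine totalDegree_finsetSum_le fun c _ => totalDegree_finsetSum_le fun u _ =>
        (totalDegree_mul _ _).trans ?_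
      have hca := hlink c a (Fin.pos u).ne'
      have hpath : N.IsCodingPath (c :: a :: b :: p) :=
        ⟨List.isChain_cons_cons.2 ⟨hca, hp.1⟩, by rw [List.getLast?_cons_cons]; exact hp.2⟩
      have := ih c hca a u (b :: p) hpath
      rw [List.length_cons] at this
      rw [totalDegree_X]
      omega

open MvPolynomial Matrix in
/-- One stage: over a large enough field, a code with the regenerating code property can be
repaired along a feasible integral subgraph such that this property is kept. -/
theorem exists_repair (N : RepairNetwork n k) {F : Type*} [Field F] [Fintype F] {M α d : ℕ}
    (hM : M = k * α) {z : Fin n → Fin n → ℕ} (hz : realLoad z ∈ N.polytope α M)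
    (hd : ∀ p, N.IsCodingPath p → p.length ≤ d)
    (hq : n.choose k * M * d < Fintype.card F) {Q : StorageCode F n M α} (hQ : HasRCP k Q) :
    ∃ Q' : StorageCode F n M α, HasRCP k Q' ∧
      ∃ R : RepairScheme F n α N.failed, R.Regenerates Q Q' ∧ R.load = z := by
  classical
  have hlink : ∀ a b, z a b ≠ 0 → N.link a b := by
    intro a b hab
    by_contra h
    exact hab (by simpa [realLoad] using hz.1 a b h)
  let vs : (a b : Fin n) → Fin (z a b) → Fin α → CodingVar α z N.failed :=
    fun a b t j => Sum.inl ⟨a, b, t, j⟩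
  let vr : (a b : Fin n) → Fin (z a b) → (c : Fin n) → Fin (z c a) → CodingVar α z N.failed :=
    fun a b t c u => Sum.inr (Sum.inl ⟨a, b, t, c, u⟩)
  let vf : Fin α → (c : Fin n) → Fin (z c N.failed) → CodingVar α z N.failed :=
    fun j c u => Sum.inr (Sum.inr (j, ⟨c, u⟩))
  obtain ⟨g, hg⟩ := N.exists_transmitted hlink
    (R := MvPolynomial (CodingVar α z N.failed) F)
    (fun a b t => fun r : Fin M => ∑ j, X (vs a b t j) * C (Q a r j))
    (fun a b t c u => X (vr a b t c u))
  have hgdeg := N.totalDegree_transmitted_add_le hlink hd Q vs vr g hg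
  let P : Fin n → Fin α → Fin M → MvPolynomial (CodingVar α z N.failed) F := fun i j r =>
    if i = N.failed then ∑ c, ∑ u, X (vf j c u) * g c N.failed u r else C (Q i r j)
  have hP : ∀ i j r, (P i j r).totalDegree ≤ d := by
    intro i j r
    simp only [P]
    split_ifs with hi
    · refine totalDegree_finsetSum_le fun c _ => totalDegree_finsetSum_le fun u _ =>
        (totalDegree_mul _ _).trans ?_
      -- The path `[c, N.failed]` reserves one degree for the final coding at the new node.
      have := hgdeg c N.failed u r []
        ⟨by simpa using hlink c _ (Fin.pos u).ne', by simp⟩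
      rw [List.length_singleton] at this
      rw [totalDegree_X]
      omega
    · rw [totalDegree_C]
      exact Nat.zero_le _
  have heval : ∀ (x : CodingVar α z N.failed → F) a b t,
      (fun r => eval x (g a b t r)) = (∑ j, x (vs a b t j) • (Q a).col j) +
        ∑ c, ∑ u, x (vr a b t c u) • fun r => eval x (g c a u r) := by
    intro x a b t
    funext r
    rw [hg]
    simp [Finset.sum_apply]
  have hPf : ∀ (x : CodingVar α z N.failed → F) j, (fun r => eval x (P N.failed j r)) =
      ∑ c, ∑ u, x (vf j c u) • fun r => eval x (g c N.failed u r) := by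
    intro x j
    funext r
    simp [P, Finset.sum_apply]
  have hPs : ∀ (x : CodingVar α z N.failed → F) i j, i ≠ N.failed →
      (fun r => eval x (P i j r)) = (Q i).col j := by
    intro x i j hi
    funext r
    simp [P, hi]
  obtain ⟨x, hx⟩ := exists_point_reconstructing hM P hP hq (by
    intro K hK
    by_cases hf : N.failed ∈ K
    · have hcard : (K.erase N.failed).card + 1 = k := by
        rw [Finset.card_erase_add_one hf, hK]
      obtain ⟨stored, relayed, final, hdet⟩ := N.exists_coefficients hlink hQ
        (Finset.notMem_erase N.failed K) hcard
        fun A hA => N.le_sum_entering hM hz (fun h => Finset.notMem_erase _ _ (hA h))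
          ((Nat.add_le_add_right (Finset.card_le_card hA) 1).trans hcard.le)
      let x : CodingVar α z N.failed → F := fun v => match v with
        | .inl ⟨a, b, t, j⟩ => stored a b t j
        | .inr (.inl ⟨a, b, t, c, u⟩) => relayed a b t c u
        | .inr (.inr (j, ⟨c, u⟩)) => final j c u
      refine ⟨x, fun s hs => hdet (fun a b t r => eval x (g a b t r))
        (heval x) s (fun i hi j => ?_) fun j => ?_⟩
      · rw [← hPs x i j (Finset.ne_of_mem_erase hi)]
        exact hs i (Finset.mem_of_mem_erase hi) j
      · have := hs _ hf j
        rw [hPf] at this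
        exact this
    -- Without the new node the contents of `K` are unchanged, so any point works.
    · refine ⟨0, fun s hs => (hasRCP_iff Q).1 hQ K hK s fun i hi j => ?_⟩
      rw [← hPs 0 i j fun h => hf (h ▸ hi)]
      exact hs i hi j)
  refine ⟨fun i => Matrix.of fun r j => eval x (P i j r), ?_, ⟨z, fun a b t j => x (vs a b t j),
    fun a b t c u => x (vr a b t c u), fun j c u => x (vf j c u)⟩, ⟨fun i hi => ?_, ?_⟩, rfl⟩
  · exact (hasRCP_iff _).2 fun K hK s hs => hx K hK s fun i hi j => hs i hi j
  · ext r j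
    exact congrFun (hPs x i j hi) r
  · exact ⟨fun a b t r => eval x (g a b t r), heval x, hPf x⟩

end RepairNetwork

/-! ### All histories -/

/-- Possible repair situations are indexed by `ι`: situation `i` has the network `N i` and the
integral subgraph `z i`. A history is the list of the situations that occurred, latest first, and
`Q h` is the code after history `h`. -/
theorem theorem1 {ι : Type*} {F : Type*} [Field F] [Fintype F]
    (n k α M nnc : ℕ) (hk : 0 < k) (hM : M = k * α)
    (N : ι → RepairNetwork n k)
    (z : ι → Fin n → Fin n → ℕ)
    (hz : ∀ i, RepairNetwork.realLoad (z i) ∈ (N i).polytope α M)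
    (hnnc : IsGreatest {m : ℕ | ∃ i, ∃ p, (N i).IsCodingPath p ∧ p.length = m} nnc)
    (hF : n.choose k * M * nnc < Fintype.card F) :
    ∃ Q : List ι → StorageCode F n M α,
      ∀ h : List ι, HasRCP k (Q h) ∧
        ∀ i : ι, ∃ R : RepairScheme F n α (N i).failed,
          R.Regenerates (Q h) (Q (i :: h)) ∧
          R.load = z i ∧
          ((∀ y ∈ (N i).polytope α M,
              (N i).repairCost (RepairNetwork.realLoad (z i)) ≤ (N i).repairCost y) →
            IsLeast ((N i).repairCost '' (N i).polytope α M)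
              ((N i).repairCost (RepairNetwork.realLoad R.load))) := by
  classical
  have hpath : ∀ i p, (N i).IsCodingPath p → p.length ≤ nnc :=
    fun i p hp => hnnc.2 ⟨i, p, hp, rfl⟩
  -- The new node alone is a coding path; hence the bound on q also covers the initial code, which
  -- needs degree 1.
  have hpos : 1 ≤ nnc := by
    obtain ⟨i, -⟩ := hnnc.1
    exact hpath i [(N i).failed] ⟨by simp, by simp⟩
  obtain ⟨Q₀, hQ₀⟩ := exists_hasRCP (F := F) (n := n) hM
    ((Nat.le_mul_of_pos_right _ hpos).trans_lt hF)
  -- The RCP is bundled with the code, so that the chosen repair is a total map that can be folded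
  -- over histories.
  have hstep : ∀ (i : ι) (Q : {Q : StorageCode F n M α // HasRCP k Q}),
      ∃ Q' : {Q : StorageCode F n M α // HasRCP k Q},
        ∃ R : RepairScheme F n α (N i).failed, R.Regenerates Q.1 Q'.1 ∧ R.load = z i := by
    intro i Q
    obtain ⟨Q', hQ', hR⟩ := (N i).exists_repair hM (hz i) (hpath i) hF Q.2
    exact ⟨⟨Q', hQ'⟩, hR⟩
  choose next hnext using hstep
  refine ⟨fun h => (h.foldr next ⟨Q₀, hQ₀⟩).1, fun h => ⟨(h.foldr next ⟨Q₀, hQ₀⟩).2, fun i => ?_⟩⟩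
  obtain ⟨R, hR, hload⟩ := hnext i (h.foldr next ⟨Q₀, hQ₀⟩)
  refine ⟨R, hR, hload, fun hmin => ?_⟩
  rw [hload]
  refine ⟨⟨_, hz i, rfl⟩, ?_⟩
  rintro _ ⟨y, hy, rfl⟩
  exact hmin y hy
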